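/- **Definitions.** All oriented matroids are given by their covectors, and *simple* means without loops, parallel elements or antiparallel elements. Let $E_n=\{1,\dots,n\}$. The topes of a simple oriented matroid on $E_n$ are its maximal covectors, regarded as vectors in $\{1,-1\}^{n}\subset\mathbb{Z}^n$. Its tope graph joins two topes when their separation set $\mathbf{S}(T,Q)=\{e\in E_n: T(e)\ne Q(e)\}$ has exactly one element. A *symmetric cycle* $\mathbf{R}$ is a cycle of length $2n$ in the tope graph whose vertex set satisfies $\mathrm{V}(\mathbf{R})=-\mathrm{V}(\mathbf{R})$. For a tope $T$, a set $\mathbf{Q}\subseteq \mathrm{V}(\mathbf{R})$ is called a minimal decomposition of $T$ if it is inclusion-minimal among the subsets of $\mathrm{V}(\mathbf{R})$ with $\sum_{Q\in\mathbf{Q}}Q=T$. For an abstract simplicial complex $\Lambda$ (with the empty face counted) and an integer $t\ge0$, let $f(\Lambda;t)=(f_0,\dots,f_t)$ with $f_j=\#\{F\in\Lambda:|F|=j\}$, and let $\beta(s;t)=\bigl(\binom s0,\dots,\binom st\bigr)$; these are row vectors. Let $\mathbf{U}(t),\mathbf{T}(t),\mathbf{S}(t),\mathbf{M}(t)$ be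 the square matrices of order $t+1$, with rows and columns indexed from $0$ to $t$, whose $(i,j)$ entries are respectively $\delta_{i+j,t}$, $\ \delta_{j-i,1}$, $\ (-1)^{j-i}\binom{t-i}{j-i}$ (equal to $0$ for $j<i$), and $(-1)^{i+j}\binom{i+j}{i}$. **Proposition.** Let $\mathcal M'$ and $\mathcal M''$ be simple oriented matroids on $E_s$ and $E_t$, where $s<t$ and $s\not\equiv t\pmod 2$. Let $\mathbf{R}'$ and $\mathbf{R}''$ be symmetric cycles in their tope graphs, and let $T'$ and $T''$ be topes of $\mathcal M'$ and $\mathcal M''$. Then $T'$ has a unique minimal decomposition $\mathbf{Q}(T',\mathbf{R}')\subseteq \mathrm{V}(\mathbf{R}')$, and $T''$ has a unique minimal decomposition $\mathbf{Q}(T'',\mathbf{R}'')\subseteq \mathrm{V}(\mathbf{R}'')$. Suppose that $|\mathbf{Q}(T',\mathbf{R}')|\ge5$ and $|\mathbf{Q}(T'',\mathbf{R}'')|\ge5$. Let $\Lambda'$ be the simplicial complex whose faces are the subsets of the sets $E_s-\mathbf{S}(T',Q')$, $Q'\in\mathbf{Q}(T',\mathbf{R}')$, and let $\Lambda''$ be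 the simplicial complex whose faces are the subsets of the sets $E_t-\mathbf{S}(T'',Q'')$, $Q''\in\mathbf{Q}(T'',\mathbf{R}'')$. Then $$\bigl(\beta(s;t)-f(\Lambda';t)\bigr)\,\mathbf{T}(t)^{t-s}\,\mathbf{M}(t)\,\bigl(\beta(t;t)-f(\Lambda'';t)\bigr)^{\top}=0 .$$ Moreover, the vectors $$h'=\bigl(\beta(s;t)-f(\Lambda';t)\bigr)\mathbf{T}(t)^{t-s}\mathbf{U}(t)\mathbf{S}(t),\qquad h''=\bigl(\beta(t;t)-f(\Lambda'';t)\bigr)\mathbf{U}(t)\mathbf{S}(t)$$ satisfy $h'_k=h'_{t-k}$ and $h''_k=-h''_{t-k}$ for $0\le k\le t$. Thus $h'$ is a (nonzero) left eigenvector of $\mathbf{U}(t)$ for the eigenvalue $1$, and $(h'')^{\top}$ is a (nonzero) right eigenvector of $\mathbf{U}(t)$ for the eigenvalue $-1$; and $\langle h',h''\rangle=0$. -/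

import Mathlib

open scoped Matrix

/-- Sign vectors on a ground set `E`. -/
abbrev SignVector (E : Type*) := E → SignType

namespace SignVector

variable {E : Type*}

/-- The composition `X ∘ Y`. -/
def comp (X Y : SignVector E) : SignVector E := fun e => if X e = 0 then Y e else X e

/-- The separation set `S(X, Y) = {e : X e = -Y e ≠ 0}`. -/
def sep [Fintype E] (X Y : SignVector E) : Finset E := {e | X e ≠ 0 ∧ X e = -Y e}

/-- The conformal order: `X` is obtained from `Y` by changing some components to `0`. -/
def Conforms (X Y : SignVector E) : Prop := ∀ e, X e ≠ 0 → X e = Y e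

end SignVector

/-- An oriented matroid on the finite ground set `E`, given by its set of covectors. -/
structure OrientedMatroid (E : Type*) [Fintype E] where
  covectors : Set (SignVector E)
  zero_mem : 0 ∈ covectors
  neg_mem : ∀ X ∈ covectors, -X ∈ covectors
  comp_mem : ∀ X ∈ covectors, ∀ Y ∈ covectors, X.comp Y ∈ covectors
  elimination : ∀ X ∈ covectors, ∀ Y ∈ covectors, ∀ e ∈ X.sep Y,
    ∃ Z ∈ covectors, Z e = 0 ∧ ∀ f ∉ X.sep Y, Z f = X.comp Y f

namespace OrientedMatroid

variable {E : Type*} [Fintype E]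

/-- No loops, no parallel elements, no antiparallel elements. -/
structure IsSimple (M : OrientedMatroid E) : Prop where
  no_loop : ∀ e, ∃ X ∈ M.covectors, X e ≠ 0
  no_parallel : ∀ e f, e ≠ f → ∃ X ∈ M.covectors, X e ≠ X f
  no_antiparallel : ∀ e f, e ≠ f → ∃ X ∈ M.covectors, X e ≠ -X f

/-- The topes are the covectors that are maximal in the conformal order. -/
def topes (M : OrientedMatroid E) : Set (SignVector E) :=
  {X | X ∈ M.covectors ∧ ∀ Y ∈ M.covectors, X.Conforms Y → Y = X}

/-- The tope graph (of a simple oriented matroid): two topes are adjacent when exactly one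
element of the ground set separates them. -/
def topeGraph (M : OrientedMatroid E) : SimpleGraph M.topes where
  Adj X Y := (X.1.sep Y.1).card = 1
  symm := ⟨fun X Y h => by
    have hs : Y.1.sep X.1 = X.1.sep Y.1 := by
      ext e
      simp only [SignVector.sep, Finset.mem_filter, Finset.mem_univ, true_and]
      generalize X.1 e = a
      generalize Y.1 e = b
      revert a b
      decide
    rw [hs]
    exact h⟩
  loopless := ⟨fun X h => by
    have hs : X.1.sep X.1 = ∅ := by
      refine Finset.filter_eq_empty_iff.mpr fun e _ => ?_
      generalize X.1 e = a
      revert a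
      decide
    simp [hs] at h⟩

/-- A symmetric cycle in the tope graph: a cycle whose length is twice the size of the ground set
and whose vertex set is closed under negation. -/
structure SymmetricCycle (M : OrientedMatroid E) where
  base : M.topes
  walk : M.topeGraph.Walk base base
  isCycle : walk.IsCycle
  length_eq : walk.length = 2 * Fintype.card E
  neg_mem : ∀ X ∈ walk.support, ∃ Y ∈ walk.support, Y.1 = -X.1

/-- The vertex set `V(R)` of a symmetric cycle. -/
def SymmetricCycle.vertexSet {M : OrientedMatroid E} (R : M.SymmetricCycle) :
    Set (SignVector E) :=
  Subtype.val '' {X : M.topes | X ∈ R.walk.support}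

/-- `Q` is an inclusion-minimal set of vertices of `R` whose sum (in `ℤ^E`) is `T`. -/
def IsMinimalDecomposition {M : OrientedMatroid E} (T : M.topes) (R : M.SymmetricCycle)
    (Q : Finset (SignVector E)) : Prop :=
  Minimal (fun Q : Finset (SignVector E) =>
    (Q : Set (SignVector E)) ⊆ R.vertexSet ∧ ∀ e, ∑ X ∈ Q, (X e : ℤ) = (T.1 e : ℤ)) Q

end OrientedMatroid

/-- The abstract simplicial complex (a down-closed family of finite sets, the empty face
included) generated by the sets `E - S(T, X)` for `X ∈ Q`. -/
def decompositionComplex {E : Type*} [Fintype E] [DecidableEq E] (T : SignVector E)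
    (Q : Finset (SignVector E)) : LowerSet (Finset E) :=
  lowerClosure {F | ∃ X ∈ Q, F = Finset.univ \ T.sep X}

/-- The long `f`-vector: `f_j(Λ; t)` is the number of faces of size `j`, for `0 ≤ j ≤ t`. -/
noncomputable def longF {E : Type*} (L : LowerSet (Finset E)) (t : ℕ) : Fin (t + 1) → ℤ :=
  fun j => ({F : Finset E | F ∈ L ∧ F.card = (j : ℕ)}.ncard : ℤ)

/-- `β(s; t) = (C(s,0), …, C(s,t))`. -/
def binomVec (s t : ℕ) : Fin (t + 1) → ℤ := fun j => (s.choose j : ℤ)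

/-- The backward identity matrix `U(t)`. -/
def backwardId (t : ℕ) : Matrix (Fin (t + 1)) (Fin (t + 1)) ℤ :=
  Matrix.of fun i j => if (i : ℕ) + j = t then 1 else 0

/-- The forward shift matrix `T(t)`. -/
def forwardShift (t : ℕ) : Matrix (Fin (t + 1)) (Fin (t + 1)) ℤ :=
  Matrix.of fun i j => if (j : ℕ) = i + 1 then 1 else 0

/-- The matrix `S(t)` with entries `(-1)^(j-i) C(t-i, j-i)`, which turns long `f`-vectors into
long `h`-vectors; it is upper triangular. -/
def fToH (t : ℕ) : Matrix (Fin (t + 1)) (Fin (t + 1)) ℤ :=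
  Matrix.of fun i j =>
    if (i : ℕ) ≤ j then (-1) ^ ((j : ℕ) - i) * ((t - i : ℕ).choose ((j : ℕ) - i) : ℤ) else 0

/-- The matrix `M(t)` with entries `(-1)^(i+j) C(i+j, i)`. -/
def signedPascal (t : ℕ) : Matrix (Fin (t + 1)) (Fin (t + 1)) ℤ :=
  Matrix.of fun i j => (-1) ^ ((i : ℕ) + j) * (((i : ℕ) + j).choose i : ℤ)

/-- For a complex `Λ` on `s ≤ t` vertices, the long `h`-vector
`h(Ω; t) = (β(s; t) - f(Λ; t)) T(t)^(t-s) U(t) S(t)` of the complex `Ω` whose faces are the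
complements of the nonfaces of `Λ`; the row vector multiplied by `S(t)` is `f(Ω; t)`. -/
noncomputable def dualLongH (s t : ℕ) (L : LowerSet (Finset (Fin s))) : Fin (t + 1) → ℤ :=
  (binomVec s t - longF L t) ᵥ* (forwardShift t ^ (t - s) * backwardId t * fToH t)

/-!
Unroll a symmetric cycle to a `2n`-periodic sequence `seq k` of vectors of signs. A vector and its
negative differ in all `n` entries, so each needs `n` steps in either direction to reach the other;
hence `seq (k + n) = -seq k`, and any `n` consecutive steps negate each entry exactly once
(`SymmetricCycle.exists_signCycle`). Everything below depends only on this (`SignCycle`) and on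
`T` having no zero entry.

*Decompositions.* The vectors of the cycle where the agreement with `T` has a local maximum sum to
`T` (`SignCycle.sum_peaks`), and each of them lies in every subset of the cycle with sum `T`
(`SignCycle.peaks_subset_of_sum_eq`). So they form the least decomposition. Every vector of the
cycle climbs to a peak, hence a set is a face of `Λ` exactly when *some* vector of the cycle agrees
with `T` on it (`mem_decompositionComplex_peaks`).

*Face numbers.* For nonempty `F`, the indices `k` such that `seq k` agrees with `T` on `F` form an
intersection of half-circles, which is an interval or empty; so a nonempty face is entered or left
by exactly two steps. Let `b k` be the number of entries at which both ends of step `k` agree with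
`T`. Counting pairs of a face and a step that crosses it gives
`2 f_{j+1}(Λ) = ∑_{k < 2n} (b k).choose j` (`SignCycle.two_mul_ncard_faces`), and antipodality gives
`b (k + n) = n - 1 - b k`.

*Long `h`-vectors.* Let `Ω` be the complex of the complements of the nonfaces of `Λ`. The entries
of `2 h(Ω; t)` are therefore the coefficients of
`(1 - X)^(t-n) (2 (1 - X^n) - (1 - X) ∑_{k < 2n} X^(b k))`
(`SignCycle.two_mul_dualLongH_peaks`). The symmetry of the numbers `b k` makes this polynomial
palindromic up to the sign `(-1)^(t-n+1)`. Its constant term is `2` unless some `b k` vanishes, that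
is, unless `T` lies on the cycle, where the decomposition is `{T}`. Finally, `M(t)` is the Gram
matrix `(U S)(U S)ᵀ` (`signedPascal_eq`), so the orthogonality relation is that of a symmetric and
an antisymmetric vector.
-/

/-! ### Sums over a period -/

theorem sum_range_add_of_periodic {M : Type*} [AddCommGroup M] {g : ℕ → M} {N : ℕ}
    (hg : ∀ k, g (k + N) = g k) (m : ℕ) :
    ∑ k ∈ Finset.range N, g (m + k) = ∑ k ∈ Finset.range N, g k := by
  induction m with
  | zero => simp
  | succ m ih =>
    rw [← ih]
    have h₁ := Finset.sum_range_succ (fun k => g (m + k)) N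
    have h₂ := Finset.sum_range_succ' (fun k => g (m + k)) N
    rw [h₁, hg m, add_zero] at h₂
    have h₃ := add_right_cancel h₂
    rw [h₃]
    exact Finset.sum_congr rfl fun k _ => by rw [add_right_comm, add_assoc]

theorem SignType.eq_neg_of_ne {a b : SignType} (ha : a ≠ 0) (hb : b ≠ 0) (h : a ≠ b) :
    a = -b := by
  revert a b; decide

theorem SignType.ne_neg_self {a : SignType} (ha : a ≠ 0) : a ≠ -a := by
  revert a; decide

/-! ### Antipodal cycles of sign vectors -/

/-- A closed walk of sign vectors without zero entries, unrolled to a sequence indexed by `ℕ`: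
the step from `seq k` to `seq (k + 1)` negates exactly the entry at `flip k`, and `card E`
steps lead from each vector to its negative. -/
structure SignCycle (E : Type*) [Fintype E] where
  seq : ℕ → SignVector E
  flip : ℕ → E
  seq_ne_zero : ∀ k e, seq k e ≠ 0
  seq_succ_flip : ∀ k, seq (k + 1) (flip k) = -seq k (flip k)
  seq_succ_of_ne : ∀ k e, e ≠ flip k → seq (k + 1) e = seq k e
  seq_add_card : ∀ k, seq (k + Fintype.card E) = -seq k

namespace SignCycle

variable {E : Type*} [Fintype E] (R : SignCycle E)

theorem card_pos (R : SignCycle E) : 0 < Fintype.card E := Fintype.card_pos_iff.mpr ⟨R.flip 0⟩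

theorem seq_periodic (k : ℕ) : R.seq (k + 2 * Fintype.card E) = R.seq k := by
  rw [two_mul, ← add_assoc, R.seq_add_card, R.seq_add_card, neg_neg]

theorem seq_add_of_forall_ne (k m : ℕ) (e : E) (h : ∀ i < m, R.flip (k + i) ≠ e) :
    R.seq (k + m) e = R.seq k e := by
  induction m with
  | zero => rfl
  | succ m ih =>
    rw [← add_assoc, R.seq_succ_of_ne _ _ (h m m.lt_succ_self).symm]
    exact ih fun i hi => h i (hi.trans m.lt_succ_self)

theorem exists_flip_eq (k : ℕ) (e : E) : ∃ i < Fintype.card E, R.flip (k + i) = e := by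
  by_contra! h
  have := R.seq_add_of_forall_ne k _ e h
  rw [R.seq_add_card] at this
  exact SignType.ne_neg_self (R.seq_ne_zero k e) this.symm

/-- Any `card E` consecutive steps negate every entry, hence negate each entry exactly once. -/
theorem flip_injOn (k : ℕ) {i j : ℕ} (hi : i < Fintype.card E) (hj : j < Fintype.card E)
    (h : R.flip (k + i) = R.flip (k + j)) : i = j := by
  have hs : Function.Surjective fun i : Fin (Fintype.card E) => R.flip (k + i) := fun e => by
    obtain ⟨i, hi, rfl⟩ := R.exists_flip_eq k e
    exact ⟨⟨i, hi⟩, rfl⟩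
  have hb := (Fintype.bijective_iff_surjective_and_card _).mpr ⟨hs, Fintype.card_fin _⟩
  exact congrArg Fin.val (hb.injective (a₁ := ⟨i, hi⟩) (a₂ := ⟨j, hj⟩) h)

theorem flip_add_card (k : ℕ) : R.flip (k + Fintype.card E) = R.flip k := by
  obtain ⟨i, hi, h⟩ := R.exists_flip_eq (k + 1) (R.flip k)
  have hi' : ¬ i + 1 < Fintype.card E := fun hlt => by
    have := R.flip_injOn k (i := i + 1) (j := 0) hlt R.card_pos
      (by rw [add_zero, ← h, add_right_comm, add_assoc])
    omega
  rw [← h, show k + Fintype.card E = k + 1 + i by omega, h]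

theorem flip_periodic (k : ℕ) : R.flip (k + 2 * Fintype.card E) = R.flip k := by
  rw [two_mul, ← add_assoc, R.flip_add_card, R.flip_add_card]

theorem seq_add_flip (k : ℕ) {m p : ℕ} (hp : p < Fintype.card E) (hm : m ≤ Fintype.card E) :
    R.seq (k + m) (R.flip (k + p)) =
      if p < m then -R.seq k (R.flip (k + p)) else R.seq k (R.flip (k + p)) := by
  induction m with
  | zero => simp
  | succ m ih =>
    have ih := ih (by omega)
    rcases eq_or_ne p m with rfl | hpm
    · rw [if_neg (lt_irrefl _)] at ih
      rw [if_pos p.lt_succ_self, ← add_assoc, R.seq_succ_flip, ih]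
    · rw [← add_assoc, R.seq_succ_of_ne _ _ fun h => hpm (R.flip_injOn k hp (by omega) h), ih]
      exact if_congr (by omega) rfl rfl

theorem seq_add_card_add (k m : ℕ) : R.seq (k + (Fintype.card E + m)) = -R.seq (k + m) := by
  rw [← R.seq_add_card, add_comm (Fintype.card E) m, add_assoc]

theorem exists_seq_add_eq (i j : ℕ) : ∃ m < 2 * Fintype.card E, R.seq (j + m) = R.seq i := by
  have hn := R.card_pos
  have hper : ∀ q k, R.seq (k + q * (2 * Fintype.card E)) = R.seq k := fun q => by
    induction q with
    | zero => simp
    | succ q ih => intro k; rw [add_mul, one_mul, ← add_assoc, R.seq_periodic, ih]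
  set N := 2 * Fintype.card E with hN
  refine ⟨(i + j * (N - 1)) % N, Nat.mod_lt _ (by omega), ?_⟩
  rw [← hper ((i + j * (N - 1)) / N), add_assoc, mul_comm _ N, Nat.mod_add_div, ← hper j i]
  congr 1
  have : j * N = j * (N - 1) + j := by
    rw [← Nat.mul_succ]; congr 1; omega
  omega

theorem seq_injOn {i j : ℕ} (hi : i < 2 * Fintype.card E) (hj : j < 2 * Fintype.card E)
    (h : R.seq i = R.seq j) : i = j := by
  wlog hij : i ≤ j generalizing i j
  · exact (this hj hi h.symm (by omega)).symm
  have hn := R.card_pos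
  by_contra hne
  obtain ⟨m, rfl⟩ := Nat.exists_eq_add_of_le hij
  rcases le_or_gt m (Fintype.card E) with hm | hm
  · have := R.seq_add_flip i (p := 0) hn hm
    rw [if_pos (by omega), ← h] at this
    exact SignType.ne_neg_self (R.seq_ne_zero _ _) this
  · obtain ⟨q, rfl⟩ := Nat.exists_eq_add_of_le hm.le
    have := R.seq_add_flip i (p := Fintype.card E - 1) (m := q) (by omega) (by omega)
    rw [if_neg (by omega)] at this
    rw [R.seq_add_card_add] at h
    rw [h, Pi.neg_apply] at this
    exact SignType.ne_neg_self (R.seq_ne_zero _ _) this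

/-! ### The decomposition of a sign vector along an antipodal cycle -/

/-- `seq (k + 1)` is a peak of the agreement with `T`: the step into it creates an agreement with
`T`, and the step out of it destroys one. -/
def IsPeak (T : SignVector E) (k : ℕ) : Prop :=
  R.seq (k + 1) (R.flip k) = T (R.flip k) ∧
    R.seq (k + 1) (R.flip (k + 1)) = T (R.flip (k + 1))

open Classical in
/-- The vectors of the cycle at which the agreement with `T` has a peak. -/
noncomputable def peaks (T : SignVector E) : Finset (SignVector E) :=
  {k ∈ Finset.range (2 * Fintype.card E) | R.IsPeak T k}.image fun k => R.seq (k + 1)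

variable {R} {T : SignVector E}

theorem mem_peaks {X : SignVector E} : X ∈ R.peaks T ↔ ∃ k, R.IsPeak T k ∧ R.seq (k + 1) = X := by
  classical
  have hn := R.card_pos
  simp only [peaks, Finset.mem_image, Finset.mem_filter, Finset.mem_range]
  refine ⟨fun ⟨k, hk, h⟩ => ⟨k, hk.2, h⟩, ?_⟩
  rintro ⟨k, hk, rfl⟩
  induction k using Nat.strong_induction_on with
  | _ k ih =>
    rcases lt_or_ge k (2 * Fintype.card E) with h | h
    · exact ⟨k, ⟨h, hk⟩, rfl⟩
    · obtain ⟨m, rfl⟩ := Nat.exists_eq_add_of_le' h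
      have h₁ : R.seq (m + 2 * Fintype.card E + 1) = R.seq (m + 1) := by
        rw [add_right_comm, R.seq_periodic]
      have h₂ : R.flip (m + 2 * Fintype.card E + 1) = R.flip (m + 1) := by
        rw [add_right_comm, R.flip_periodic]
      unfold IsPeak at hk
      rw [h₁, h₂, R.flip_periodic] at hk
      rw [h₁]
      exact ih m (by omega) hk

/-- Pairing with the two entries negated around a peak shows that the peak occurs in every
decomposition of `T` along the cycle. -/
theorem peaks_subset_of_sum_eq {Q : Finset (SignVector E)} (hQ : (Q : Set _) ⊆ Set.range R.seq)
    (hsum : ∀ e, ∑ X ∈ Q, (X e : ℤ) = (T e : ℤ)) : R.peaks T ⊆ Q := by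
  intro X hX
  obtain ⟨k, ⟨h₁, h₂⟩, rfl⟩ := mem_peaks.mp hX
  by_contra hXQ
  have hn := R.card_pos
  set e := R.flip k
  set f := R.flip (k + 1)
  have hpair : ∑ Y ∈ Q, ((Y e : ℤ) * T e + (Y f : ℤ) * T f) = 2 := by
    rw [Finset.sum_add_distrib, ← Finset.sum_mul, ← Finset.sum_mul, hsum, hsum]
    have hsq : ∀ a : SignType, a ≠ 0 → (a : ℤ) * a = 1 := by decide
    rw [hsq _ (h₁ ▸ R.seq_ne_zero _ _), hsq _ (h₂ ▸ R.seq_ne_zero _ _)]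
    rfl
  have hle : ∀ Y ∈ Q, (Y e : ℤ) * T e + (Y f : ℤ) * T f ≤ 0 := by
    intro Y hY
    obtain ⟨i, rfl⟩ := hQ hY
    obtain ⟨m, hm, hi⟩ := R.exists_seq_add_eq i (k + 1)
    have hm0 : m ≠ 0 := by
      rintro rfl
      exact hXQ (by rwa [← hi] at hY)
    have hone : R.seq i e = -T e ∨ R.seq i f = -T f := by
      rw [← hi, ← h₁, ← h₂]
      rcases le_or_gt m (Fintype.card E) with hmn | hmn
      · right
        have := R.seq_add_flip (k + 1) (p := 0) hn hmn
        rwa [if_pos (by omega)] at this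
      · left
        obtain ⟨q, rfl⟩ := Nat.exists_eq_add_of_le hmn.le
        have he : e = R.flip (k + 1 + (Fintype.card E - 1)) := by
          rw [show k + 1 + (Fintype.card E - 1) = k + Fintype.card E by omega, R.flip_add_card]
        have := R.seq_add_flip (k + 1) (p := Fintype.card E - 1) (m := q) (by omega) (by omega)
        rw [if_neg (by omega), ← he] at this
        rw [R.seq_add_card_add, Pi.neg_apply, this]
    have hneg : ∀ a b c d : SignType, a ≠ 0 → c ≠ 0 → b ≠ 0 → d ≠ 0 → a = -b ∨ c = -d →
        (a : ℤ) * b + (c : ℤ) * d ≤ 0 := by decide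
    exact hneg _ _ _ _ (R.seq_ne_zero _ _) (R.seq_ne_zero _ _) (h₁ ▸ R.seq_ne_zero _ _)
      (h₂ ▸ R.seq_ne_zero _ _) hone
  have := Finset.sum_nonpos hle
  omega

theorem sum_range_two_mul_ite_flip_eq [DecidableEq E] (e : E) (a : ℤ) :
    ∑ k ∈ Finset.range (2 * Fintype.card E), (if R.flip k = e then a else 0) = 2 * a := by
  have hone : ∑ k ∈ Finset.range (Fintype.card E), (if R.flip k = e then a else 0) = a := by
    obtain ⟨i, hi, h⟩ := R.exists_flip_eq 0 e
    rw [zero_add] at h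
    rw [Finset.sum_eq_single_of_mem i (Finset.mem_range.mpr hi), if_pos h]
    intro j hj hji
    refine if_neg fun hj' => hji ?_
    refine R.flip_injOn 0 (Finset.mem_range.mp hj) hi ?_
    rw [zero_add, zero_add, h, hj']
  rw [two_mul, Finset.sum_range_add, hone]
  simp_rw [add_comm (Fintype.card E), R.flip_add_card, hone]
  ring

/-- The peaks add up to `T`. With `u k = T (flip k) * seq k (flip k)`, the indicator of a peak at
`k + 1` minus that of a peak at the antipode is `(u (k + 1) - u k) / 2`; summation by parts over
the period leaves `u k * (seq k - seq (k + 1))`, which is supported on the entry `flip k`. -/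
theorem sum_peaks (hT : ∀ e, T e ≠ 0) (e : E) : ∑ X ∈ R.peaks T, (X e : ℤ) = (T e : ℤ) := by
  classical
  have hn := R.card_pos
  set n := Fintype.card E with hn_def
  let r : ℕ → ℤ := fun k => (R.seq k e : ℤ)
  let u : ℕ → ℤ := fun k => (T (R.flip k) : ℤ) * (R.seq k (R.flip k) : ℤ)
  let p : ℕ → ℤ := fun k => if R.IsPeak T k then 1 else 0
  have hr : ∀ k, r (k + n) = -r k := fun k => by
    simp only [r, n, R.seq_add_card, Pi.neg_apply]
    generalize R.seq k e = a
    revert a; decide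
  have hr2 : ∀ k, r (k + 2 * n) = r k := fun k => by simp only [r, n, R.seq_periodic]
  have hu : ∀ k, u (k + n) = -u k := fun k => by
    simp only [u, n, R.seq_add_card, R.flip_add_card, Pi.neg_apply]
    generalize T (R.flip k) = a
    generalize R.seq k (R.flip k) = b
    revert a b; decide
  have hu2 : ∀ k, u (k + 2 * n) = u k := fun k => by
    rw [two_mul, ← add_assoc, hu, hu, neg_neg]
  have hpu : ∀ k, p k = if u k = -1 ∧ u (k + 1) = 1 then 1 else 0 := fun k => by
    refine if_congr ?_ rfl rfl
    simp only [IsPeak, u, R.seq_succ_flip k]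
    have h₁ : ∀ a b : SignType, a ≠ 0 → b ≠ 0 → (-b = a ↔ (a : ℤ) * b = -1) := by decide
    have h₂ : ∀ a b : SignType, a ≠ 0 → b ≠ 0 → (b = a ↔ (a : ℤ) * b = 1) := by decide
    rw [h₁ _ _ (hT _) (R.seq_ne_zero _ _), h₂ _ _ (hT _) (R.seq_ne_zero _ _)]
  have hu1 : ∀ k, u k = 1 ∨ u k = -1 := fun k => by
    have h : ∀ a b : SignType, a ≠ 0 → b ≠ 0 → ((a : ℤ) * b = 1 ∨ (a : ℤ) * b = -1) := by decide
    exact h _ _ (hT _) (R.seq_ne_zero _ _)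
  have hp2 : ∀ k, p (k + 2 * n) = p k := fun k => by
    rw [hpu, hpu, add_right_comm, hu2, hu2]
  have hdiff : ∀ k, 2 * (p k - p (n + k)) = u (k + 1) - u k := fun k => by
    rw [hpu, hpu, add_comm n k, add_right_comm, hu, hu]
    rcases hu1 k with h | h <;> rcases hu1 (k + 1) with h' | h' <;> rw [h, h'] <;> norm_num
  have hsum : ∑ X ∈ R.peaks T, (X e : ℤ) = ∑ k ∈ Finset.range (2 * n), p k * r (k + 1) := by
    rw [peaks, Finset.sum_image, Finset.sum_filter]
    · exact Finset.sum_congr rfl fun k _ => by simp only [p, r, ite_mul, one_mul, zero_mul]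
    · intro i hi j hj hij
      have hi := Finset.mem_range.mp (Finset.mem_filter.mp hi).1
      have hj := Finset.mem_range.mp (Finset.mem_filter.mp hj).1
      have hij : R.seq (i + 1) = R.seq (j + 1) := hij
      -- the indices `i + 1`, `j + 1` run through `1, …, 2 * n`, and `2 * n` acts like `0`
      rcases Nat.lt_or_ge (i + 1) (2 * n) with h | h <;>
      rcases Nat.lt_or_ge (j + 1) (2 * n) with h' | h'
      · have := R.seq_injOn h h' hij; omega
      · rw [show j + 1 = 0 + 2 * n by omega, R.seq_periodic] at hij
        have := R.seq_injOn h (by omega) hij; omega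
      · rw [show i + 1 = 0 + 2 * n by omega, R.seq_periodic] at hij
        have := R.seq_injOn (by omega) h' hij; omega
      · omega
  have hshift : ∑ k ∈ Finset.range (2 * n), p k * r (k + 1) =
      -∑ k ∈ Finset.range (2 * n), p (n + k) * r (k + 1) := by
    rw [← sum_range_add_of_periodic (g := fun k => p k * r (k + 1)) (N := 2 * n)
      (fun k => by rw [hp2, add_right_comm, hr2]) n, ← Finset.sum_neg_distrib]
    refine Finset.sum_congr rfl fun k _ => ?_
    rw [show n + k + 1 = k + 1 + n by ring, hr]
    ring
  have hparts : ∑ k ∈ Finset.range (2 * n), u (k + 1) * r (k + 1) =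
      ∑ k ∈ Finset.range (2 * n), u k * r k := by
    rw [← sum_range_add_of_periodic (g := fun k => u k * r k) (N := 2 * n)
      (fun k => by rw [hu2, hr2]) 1]
    exact Finset.sum_congr rfl fun k _ => by rw [add_comm 1 k]
  have hstep : ∀ k, u k * r k - u k * r (k + 1) = if R.flip k = e then 2 * (T e : ℤ) else 0 := by
    intro k
    split_ifs with h
    · subst h
      simp only [u, r, R.seq_succ_flip]
      have hs : ∀ a b : SignType, b ≠ 0 →
          (a : ℤ) * b * b - (a : ℤ) * b * ((-b : SignType) : ℤ) = 2 * a := by decide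
      exact hs _ _ (R.seq_ne_zero _ _)
    · simp only [r, R.seq_succ_of_ne k e (Ne.symm h), sub_self]
  have htotal : ∑ k ∈ Finset.range (2 * n), 2 * (p k - p (n + k)) * r (k + 1) = 4 * (T e : ℤ) := by
    calc _ = ∑ k ∈ Finset.range (2 * n), u (k + 1) * r (k + 1) -
          ∑ k ∈ Finset.range (2 * n), u k * r (k + 1) := by
            rw [← Finset.sum_sub_distrib]
            exact Finset.sum_congr rfl fun k _ => by rw [hdiff]; ring
      _ = ∑ k ∈ Finset.range (2 * n), if R.flip k = e then 2 * (T e : ℤ) else 0 := by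
            rw [hparts, ← Finset.sum_sub_distrib]
            exact Finset.sum_congr rfl fun k _ => hstep k
      _ = _ := by rw [sum_range_two_mul_ite_flip_eq]; ring
  have hsplit : ∑ k ∈ Finset.range (2 * n), 2 * (p k - p (n + k)) * r (k + 1) =
      2 * ∑ k ∈ Finset.range (2 * n), p k * r (k + 1) -
        2 * ∑ k ∈ Finset.range (2 * n), p (n + k) * r (k + 1) := by
    rw [Finset.mul_sum, Finset.mul_sum, ← Finset.sum_sub_distrib]
    exact Finset.sum_congr rfl fun k _ => by ring
  rw [hsum]
  linarith

/-- From any vector of the cycle one can climb to a peak without losing agreements with `T`. -/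
theorem exists_isPeak_of_agree (hT : ∀ e, T e ≠ 0) (k : ℕ) :
    ∃ j, R.IsPeak T j ∧ ∀ e, R.seq k e = T e → R.seq (j + 1) e = T e := by
  classical
  induction hd : Finset.card {e | R.seq k e ≠ T e} using Nat.strong_induction_on
    generalizing k with
  | _ d ih =>
    have hn := R.card_pos
    obtain ⟨j, hj⟩ : ∃ j, j + 1 = k + 2 * Fintype.card E :=
      ⟨k + 2 * Fintype.card E - 1, by omega⟩
    have hk : R.seq k = R.seq (j + 1) := by rw [hj, R.seq_periodic]
    rw [hk] at hd ⊢
    have climb : ∀ (i : ℕ) (f : E), R.seq i f ≠ R.seq (j + 1) f →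
        (∀ e, e ≠ f → R.seq i e = R.seq (j + 1) e) → R.seq (j + 1) f ≠ T f →
        ∃ j', R.IsPeak T j' ∧ ∀ e, R.seq (j + 1) e = T e → R.seq (j' + 1) e = T e := by
      intro i f h₁ h₂ h₃
      have hf : R.seq i f = T f := by
        rw [SignType.eq_neg_of_ne (R.seq_ne_zero _ _) (R.seq_ne_zero _ _) h₁,
          SignType.eq_neg_of_ne (R.seq_ne_zero _ _) (hT _) h₃, neg_neg]
      have hsub : ∀ e, R.seq (j + 1) e = T e → R.seq i e = T e := fun e he => by
        rw [h₂ e fun hef => h₃ (hef ▸ he), he]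
      have hlt : Finset.card {e | R.seq i e ≠ T e} < d := by
        rw [← hd]
        refine Finset.card_lt_card (Finset.ssubset_iff_of_subset ?_ |>.mpr ⟨f, ?_, ?_⟩)
        · intro e he
          simp only [Finset.mem_filter, Finset.mem_univ, true_and] at he ⊢
          exact fun h => he (hsub e h)
        · simpa using h₃
        · simpa using hf
      obtain ⟨j', hj', h⟩ := ih _ hlt i rfl
      exact ⟨j', hj', fun e he => h e (hsub e he)⟩
    by_cases h₁ : R.seq (j + 1) (R.flip j) = T (R.flip j)
    · by_cases h₂ : R.seq (j + 1) (R.flip (j + 1)) = T (R.flip (j + 1))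
      · exact ⟨j, ⟨h₁, h₂⟩, fun e he => he⟩
      · refine climb (j + 1 + 1) (R.flip (j + 1)) ?_ (fun e he => R.seq_succ_of_ne _ _ he) h₂
        rw [R.seq_succ_flip]
        exact (SignType.ne_neg_self (R.seq_ne_zero _ _)).symm
    · refine climb j (R.flip j) ?_ (fun e he => (R.seq_succ_of_ne _ _ he).symm) h₁
      rw [R.seq_succ_flip]
      exact SignType.ne_neg_self (R.seq_ne_zero _ _)

end SignCycle

/-! ### Symmetric cycles in tope graphs -/

namespace SignVector

variable {E : Type*} [Fintype E]

theorem mem_sep {X Y : SignVector E} (hX : ∀ e, X e ≠ 0) (hY : ∀ e, Y e ≠ 0) {e : E} :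
    e ∈ X.sep Y ↔ X e ≠ Y e := by
  have h : ∀ a b : SignType, a ≠ 0 → b ≠ 0 → (a ≠ 0 ∧ a = -b ↔ a ≠ b) := by decide
  simpa [sep] using h _ _ (hX e) (hY e)

theorem card_sep_triangle [DecidableEq E] {X Y Z : SignVector E} (hX : ∀ e, X e ≠ 0)
    (hY : ∀ e, Y e ≠ 0) (hZ : ∀ e, Z e ≠ 0) :
    (X.sep Z).card ≤ (X.sep Y).card + (Y.sep Z).card := by
  refine (Finset.card_le_card fun e he => ?_).trans (Finset.card_union_le _ _)
  rw [mem_sep hX hZ] at he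
  rw [Finset.mem_union, mem_sep hX hY, mem_sep hY hZ]
  by_contra! h
  exact he (h.1.trans h.2)

/-- A walk of sign vectors needs at least as many steps as there are separating entries. -/
theorem card_sep_le_of_walk {r : ℕ → SignVector E} (hr : ∀ k e, r k e ≠ 0)
    (hstep : ∀ k, ((r k).sep (r (k + 1))).card = 1) (k m : ℕ) :
    ((r k).sep (r (k + m))).card ≤ m := by
  classical
  induction m with
  | zero => simp [Finset.eq_empty_iff_forall_notMem, mem_sep (hr k) (hr k)]
  | succ m ih =>
    have h₁ := card_sep_triangle (hr k) (hr (k + m)) (hr (k + m + 1))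
    have h₂ := hstep (k + m)
    rw [← add_assoc]
    omega

end SignVector

/-- A closed walk of `2 * card E` sign vectors without zero entries, each step negating one entry,
is antipodal as soon as its set of vertices is closed under negation: a vector and its negative
are separated by `card E` entries, so they lie `card E` steps apart in both directions. -/
theorem exists_signCycle {E : Type*} [Fintype E] {r : ℕ → SignVector E} (hr : ∀ k e, r k e ≠ 0)
    (hper : ∀ k, r (k + 2 * Fintype.card E) = r k)
    (hstep : ∀ k, ((r k).sep (r (k + 1))).card = 1)
    (hneg : ∀ k, ∃ m < 2 * Fintype.card E, r (k + m) = -r k) :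
    ∃ R : SignCycle E, R.seq = r := by
  choose flip hflip using fun k => Finset.card_eq_one.mp (hstep k)
  have hmem : ∀ k e, e = flip k ↔ r k e ≠ r (k + 1) e := fun k e => by
    rw [← SignVector.mem_sep (hr k) (hr (k + 1)), hflip, Finset.mem_singleton]
  refine ⟨⟨r, flip, hr, fun k => ?_, fun k e he => ?_, fun k => ?_⟩, rfl⟩
  · exact SignType.eq_neg_of_ne (hr _ _) (hr _ _) ((hmem k _).mp rfl).symm
  · by_contra h
    exact he ((hmem k e).mpr (Ne.symm h))
  · obtain ⟨m, hm, h⟩ := hneg k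
    have hfull : ∀ X : SignVector E, (∀ e, X e ≠ 0) → (X.sep (-X)).card = Fintype.card E := by
      intro X hX
      rw [← Finset.card_univ]
      congr 1
      ext e
      simpa [SignVector.sep] using hX e
    have h₁ := SignVector.card_sep_le_of_walk hr hstep k m
    rw [h, hfull _ (hr k)] at h₁
    have h₂ := SignVector.card_sep_le_of_walk hr hstep (k + m) (2 * Fintype.card E - m)
    rw [add_assoc, Nat.add_sub_cancel' hm.le, hper, h] at h₂
    have h₃ := hfull (-r k) fun e => by rw [← h]; exact hr _ e
    rw [neg_neg] at h₃
    rw [← h, show m = Fintype.card E by omega]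

namespace OrientedMatroid

variable {E : Type*} [Fintype E] {M : OrientedMatroid E}

theorem IsSimple.tope_ne_zero (hM : M.IsSimple) {X : SignVector E} (hX : X ∈ M.topes) (e : E) :
    X e ≠ 0 := by
  intro he
  obtain ⟨Y, hY, hYe⟩ := hM.no_loop e
  have hXY : X.comp Y = X := hX.2 _ (M.comp_mem _ hX.1 _ hY) fun f hf => by
    simp [SignVector.comp, hf]
  have := congrFun hXY e
  simp only [SignVector.comp, he, if_true] at this
  exact hYe this

theorem SymmetricCycle.exists_signCycle (hM : M.IsSimple) (R : M.SymmetricCycle) :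
    ∃ C : SignCycle E, Set.range C.seq = R.vertexSet := by
  set N := 2 * Fintype.card E with hN
  have hpos : 0 < N := by
    have := R.isCycle.three_le_length
    rw [R.length_eq] at this
    omega
  let r : ℕ → SignVector E := fun k => (R.walk.getVert (k % N)).1
  have hper : ∀ k, r (k + N) = r k := fun k => by simp [r]
  have hval : ∀ k ≤ N, r k = (R.walk.getVert k).1 := fun k hk => by
    rcases hk.lt_or_eq with hk | rfl
    · simp only [r, Nat.mod_eq_of_lt hk]
    · have h := R.walk.getVert_length
      rw [R.length_eq] at h
      simp only [r, Nat.mod_self, SimpleGraph.Walk.getVert_zero]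
      exact congrArg Subtype.val h.symm
  have hr : ∀ k e, r k e ≠ 0 := fun k e => hM.tope_ne_zero (Subtype.prop _) e
  have hrange : ∀ X ∈ R.walk.support, ∃ i < N, r i = X.1 := fun X hX => by
    obtain ⟨i, rfl, hi⟩ := SimpleGraph.Walk.mem_support_iff_exists_getVert.mp hX
    rw [R.length_eq] at hi
    refine ⟨i % N, Nat.mod_lt _ hpos, ?_⟩
    rw [← hval i hi]
    simp only [r, Nat.mod_mod]
  have hstep : ∀ k, ((r k).sep (r (k + 1))).card = 1 := fun k => by
    have hk := Nat.mod_lt k hpos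
    have hadj := R.walk.adj_getVert_succ (i := k % N) (by rw [R.length_eq]; exact hk)
    have h₁ : r (k + 1) = r (k % N + 1) := by simp [r]
    rw [h₁, hval _ hk]
    exact hadj
  obtain ⟨C, hC⟩ := _root_.exists_signCycle hr hper hstep fun k => by
    obtain ⟨Y, hY, hYX⟩ := R.neg_mem _ (R.walk.getVert_mem_support (k % N))
    obtain ⟨i, hi, hiY⟩ := hrange Y hY
    have hk := Nat.mod_lt k hpos
    refine ⟨(i + (N - k % N)) % N, Nat.mod_lt _ hpos, ?_⟩
    rw [← hYX, ← hiY]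
    have : (k + (i + (N - k % N)) % N) % N = i % N := by
      rw [Nat.add_mod, Nat.mod_mod, ← Nat.add_mod, ← Nat.mod_add_mod,
        show k % N + (i + (N - k % N)) = i + N by omega, Nat.add_mod_right]
    simp only [r, this]
  refine ⟨C, ?_⟩
  rw [hC]
  ext X
  constructor
  · rintro ⟨k, rfl⟩
    exact ⟨_, R.walk.getVert_mem_support _, rfl⟩
  · rintro ⟨X, hX, rfl⟩
    obtain ⟨i, -, hi⟩ := hrange X hX
    exact ⟨i, hi⟩

/-- The peaks of the agreement with a tope form its least, hence its unique minimal,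
decomposition along a symmetric cycle. -/
theorem isMinimalDecomposition_iff (hM : M.IsSimple) {R : M.SymmetricCycle} {C : SignCycle E}
    (hC : Set.range C.seq = R.vertexSet) (T : M.topes) {Q : Finset (SignVector E)} :
    IsMinimalDecomposition T R Q ↔ Q = C.peaks T.1 := by
  have hT := hM.tope_ne_zero T.2
  have hpeaks : (C.peaks T.1 : Set _) ⊆ R.vertexSet ∧
      ∀ e, ∑ X ∈ C.peaks T.1, (X e : ℤ) = (T.1 e : ℤ) := by
    refine ⟨fun X hX => ?_, C.sum_peaks hT⟩
    obtain ⟨k, -, rfl⟩ := SignCycle.mem_peaks.mp hX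
    exact hC ▸ ⟨k + 1, rfl⟩
  constructor
  · intro h
    have hsub := SignCycle.peaks_subset_of_sum_eq (hC ▸ h.prop.1) h.prop.2
    exact (hsub.antisymm (h.2 hpeaks hsub)).symm
  · rintro rfl
    exact ⟨hpeaks, fun Q hQ _ => SignCycle.peaks_subset_of_sum_eq (hC ▸ hQ.1) hQ.2⟩

end OrientedMatroid

theorem mem_decompositionComplex_peaks {E : Type*} [Fintype E] [DecidableEq E] {C : SignCycle E}
    {T : SignVector E} (hT : ∀ e, T e ≠ 0) {F : Finset E} :
    F ∈ decompositionComplex T (C.peaks T) ↔ ∃ k, ∀ e ∈ F, C.seq k e = T e := by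
  have hface : ∀ k, F ⊆ Finset.univ \ T.sep (C.seq k) ↔ ∀ e ∈ F, C.seq k e = T e := fun k => by
    simp only [Finset.subset_iff, Finset.mem_sdiff, Finset.mem_univ, true_and,
      SignVector.mem_sep hT (C.seq_ne_zero k), not_not, eq_comm]
  simp only [decompositionComplex, mem_lowerClosure, Set.mem_ofPred_eq]
  constructor
  · rintro ⟨_, ⟨X, hX, rfl⟩, hF⟩
    obtain ⟨k, -, rfl⟩ := SignCycle.mem_peaks.mp hX
    exact ⟨k + 1, (hface _).mp hF⟩
  · rintro ⟨k, hk⟩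
    obtain ⟨j, hj, hjk⟩ := C.exists_isPeak_of_agree hT k
    exact ⟨_, ⟨_, SignCycle.mem_peaks.mpr ⟨j, hj, rfl⟩, rfl⟩,
      (hface _).mpr fun e he => hjk e (hk e he)⟩

namespace SignCycle

variable {E : Type*} [Fintype E] (R : SignCycle E) {T : SignVector E}

/-! ### The face numbers of the complex of agreement sets -/

/-- The step at `k` crosses `F`: it negates an entry of `F`, and `seq k` agrees with `T` on the
rest of `F`. Equivalently, exactly one of `seq k` and `seq (k + 1)` agrees with `T` on `F`. -/
def Crosses (T : SignVector E) (F : Finset E) (k : ℕ) : Prop :=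
  R.flip k ∈ F ∧ ∀ e ∈ F, e ≠ R.flip k → R.seq k e = T e

open Classical in
/-- The number of entries other than the negated one at which the two ends of the step at `k`
agree with `T`. -/
noncomputable def commonAgree (T : SignVector E) (k : ℕ) : ℕ :=
  Finset.card {e | e ≠ R.flip k ∧ R.seq k e = T e}

variable {R}

theorem Crosses.exists_agree (hT : ∀ e, T e ≠ 0) {F : Finset E} {k : ℕ} (h : R.Crosses T F k) :
    ∃ j, ∀ e ∈ F, R.seq j e = T e := by
  by_cases hk : R.seq k (R.flip k) = T (R.flip k)
  · refine ⟨k, fun e he => ?_⟩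
    rcases eq_or_ne e (R.flip k) with rfl | hne
    exacts [hk, h.2 e he hne]
  · refine ⟨k + 1, fun e he => ?_⟩
    rcases eq_or_ne e (R.flip k) with rfl | hne
    · rw [R.seq_succ_flip, SignType.eq_neg_of_ne (R.seq_ne_zero _ _) (hT _) hk, neg_neg]
    · rw [R.seq_succ_of_ne _ _ hne, h.2 e he hne]

theorem crosses_periodic {F : Finset E} (k : ℕ) :
    R.Crosses T F (k + 2 * Fintype.card E) ↔ R.Crosses T F k := by
  simp only [Crosses, R.flip_periodic, R.seq_periodic]

/-- The indices at which the cycle agrees with `T` on a nonempty face form a single cyclic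
interval, as an intersection of half-circles with a common point; its two ends are the crossings.
Counted from an index of agreement, they are the first step that negates an entry of the face,
and the antipode of the last one. -/
theorem card_crosses_of_agree [DecidableEq E] {F : Finset E} (hF : F.Nonempty) {j : ℕ}
    (hj : ∀ e ∈ F, R.seq j e = T e) [DecidablePred (R.Crosses T F)] :
    Finset.card {k ∈ Finset.range (2 * Fintype.card E) | R.Crosses T F k} = 2 := by
  set n := Fintype.card E with hn
  have hpos := R.card_pos
  let P : Finset ℕ := {p ∈ Finset.range n | R.flip (j + p) ∈ F}
  have hP : ∀ p, p ∈ P ↔ p < n ∧ R.flip (j + p) ∈ F := by simp [P]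
  have hPne : P.Nonempty := by
    obtain ⟨e, he⟩ := hF
    obtain ⟨i, hi, rfl⟩ := R.exists_flip_eq j e
    exact ⟨i, (hP i).mpr ⟨hi, he⟩⟩
  have hTP : ∀ p ∈ P, T (R.flip (j + p)) = R.seq j (R.flip (j + p)) := fun p hp =>
    (hj _ ((hP p).mp hp).2).symm
  have hcross : ∀ k, R.Crosses T F (j + k) ↔ R.flip (j + k) ∈ F ∧
      ∀ p ∈ P, R.flip (j + p) ≠ R.flip (j + k) →
        R.seq (j + k) (R.flip (j + p)) = R.seq j (R.flip (j + p)) := fun k => by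
    refine and_congr_right fun _ => ⟨fun h p hp hne => ?_, fun h e he hne => ?_⟩
    · rw [h _ ((hP p).mp hp).2 hne, hTP p hp]
    · obtain ⟨i, hi, rfl⟩ := R.exists_flip_eq j e
      have hiP := (hP i).mpr ⟨hi, he⟩
      rw [h i hiP hne, hTP i hiP]
  have hself : ∀ m p, R.seq m p ≠ -R.seq m p := fun m p => SignType.ne_neg_self (R.seq_ne_zero m p)
  have hlow : ∀ k < n, (R.Crosses T F (j + k) ↔ k = P.min' hPne) := fun k hk => by
    rw [hcross]
    constructor
    · rintro ⟨h₁, h₂⟩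
      refine (P.min'_eq_iff hPne k).mpr ⟨(hP k).mpr ⟨hk, h₁⟩, fun p hp => ?_⟩ |>.symm
      by_contra! hpk
      have hp' := ((hP p).mp hp).1
      have := h₂ p hp fun h => hpk.ne (R.flip_injOn j hp' hk h)
      rw [R.seq_add_flip j hp' hk.le, if_pos hpk] at this
      exact hself _ _ this.symm
    · intro h
      have hkP : k ∈ P := h ▸ P.min'_mem hPne
      refine ⟨((hP k).mp hkP).2, fun p hp _ => ?_⟩
      have : k ≤ p := h ▸ P.min'_le p hp
      rw [R.seq_add_flip j ((hP p).mp hp).1 hk.le, if_neg (by omega)]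
  have hhigh : ∀ k < n, (R.Crosses T F (j + (n + k)) ↔ k = P.max' hPne) := fun k hk => by
    rw [hcross, R.seq_add_card_add, show j + (n + k) = j + k + n by ring, R.flip_add_card]
    constructor
    · rintro ⟨h₁, h₂⟩
      refine (P.max'_eq_iff hPne k).mpr ⟨(hP k).mpr ⟨hk, h₁⟩, fun p hp => ?_⟩ |>.symm
      by_contra! hpk
      have hp' := ((hP p).mp hp).1
      have := h₂ p hp fun h => hpk.ne' (R.flip_injOn j hp' hk h)
      rw [Pi.neg_apply, R.seq_add_flip j hp' hk.le, if_neg (by omega)] at this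
      exact hself _ _ this.symm
    · intro h
      have hkP : k ∈ P := h ▸ P.max'_mem hPne
      refine ⟨((hP k).mp hkP).2, fun p hp hne => ?_⟩
      have h₁ : p ≤ k := h ▸ P.le_max' p hp
      have h₂ : p ≠ k := fun h => hne (h ▸ rfl)
      rw [Pi.neg_apply, R.seq_add_flip j ((hP p).mp hp).1 hk.le, if_pos (by omega), neg_neg]
  have hcount : ∀ x ∈ P, ∑ k ∈ Finset.range n, (if k = x then (1 : ℤ) else 0) = 1 := fun x hx => by
    rw [Finset.sum_ite_eq' , if_pos (Finset.mem_range.mpr ((hP x).mp hx).1)]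
  have hsum : ∑ k ∈ Finset.range (2 * n), (if R.Crosses T F k then (1 : ℤ) else 0) = 2 := by
    rw [← sum_range_add_of_periodic (g := fun k => if R.Crosses T F k then (1 : ℤ) else 0)
      (N := 2 * n) (fun k => if_congr (crosses_periodic k) rfl rfl) j, two_mul,
      Finset.sum_range_add]
    rw [Finset.sum_congr rfl fun k hk => if_congr (hlow k (Finset.mem_range.mp hk)) rfl rfl,
      Finset.sum_congr rfl fun k hk => if_congr (hhigh k (Finset.mem_range.mp hk)) rfl rfl,
      hcount _ (P.min'_mem hPne), hcount _ (P.max'_mem hPne)]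
    norm_num
  rw [Finset.sum_boole] at hsum
  exact_mod_cast hsum

theorem card_filter_crosses [DecidableEq E] (k j : ℕ)
    [DecidablePred fun F => R.Crosses T F k] :
    Finset.card {F ∈ Finset.powersetCard (j + 1) (Finset.univ : Finset E) | R.Crosses T F k} =
      (R.commonAgree T k).choose j := by
  classical
  set B : Finset E := {e | e ≠ R.flip k ∧ R.seq k e = T e} with hB
  have hfB : ∀ F ∈ Finset.powersetCard j B, R.flip k ∉ F := fun F hF h => by
    have := (Finset.mem_powersetCard.mp hF).1 h
    simp [hB] at this
  have hb : R.commonAgree T k = B.card := by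
    unfold commonAgree; congr!
  rw [hb, ← Finset.card_powersetCard]
  refine (Finset.card_nbij' (fun F => insert (R.flip k) F) (fun F => F.erase (R.flip k))
    ?_ ?_ ?_ ?_).symm
  · intro F hF
    have hk := hfB F hF
    obtain ⟨hFB, hcard⟩ := Finset.mem_powersetCard.mp hF
    refine Finset.mem_filter.mpr ⟨Finset.mem_powersetCard.mpr ⟨Finset.subset_univ _, ?_⟩,
      Finset.mem_insert_self _ _, fun e he hne => ?_⟩
    · rw [Finset.card_insert_of_notMem hk, hcard]
    · have := hFB (Finset.mem_of_mem_insert_of_ne he hne)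
      exact (Finset.mem_filter.mp this).2.2
  · intro F hF
    obtain ⟨hF, hk, hF'⟩ := Finset.mem_filter.mp hF
    refine Finset.mem_powersetCard.mpr ⟨fun e he => ?_, ?_⟩
    · obtain ⟨hne, he⟩ := Finset.mem_erase.mp he
      exact Finset.mem_filter.mpr ⟨Finset.mem_univ _, hne, hF' e he hne⟩
    · rw [Finset.card_erase_of_mem hk, (Finset.mem_powersetCard.mp hF).2, Nat.add_sub_cancel]
  · intro F hF
    exact Finset.erase_insert (hfB F hF)
  · intro F hF
    exact Finset.insert_erase (Finset.mem_filter.mp hF).2.1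

/-- Twice the number of faces with `j + 1` elements: each of them is crossed by two steps, and
the step at `k` crosses `(commonAgree T k).choose j` of them. -/
theorem two_mul_ncard_faces (hT : ∀ e, T e ≠ 0) (j : ℕ) :
    2 * {F : Finset E | (∃ k, ∀ e ∈ F, R.seq k e = T e) ∧ F.card = j + 1}.ncard =
      ∑ k ∈ Finset.range (2 * Fintype.card E), (R.commonAgree T k).choose j := by
  classical
  have hset : {F : Finset E | (∃ k, ∀ e ∈ F, R.seq k e = T e) ∧ F.card = j + 1} =
      (Finset.filter (fun F => ∃ k, ∀ e ∈ F, R.seq k e = T e)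
        (Finset.powersetCard (j + 1) (Finset.univ : Finset E)) : Finset (Finset E)) := by
    ext F
    simp [Finset.mem_powersetCard, and_comm]
  rw [hset, Set.ncard_coe_finset, mul_comm, ← smul_eq_mul, ← Finset.sum_const, Finset.sum_filter]
  have hrow : ∀ F ∈ Finset.powersetCard (j + 1) (Finset.univ : Finset E),
      (if ∃ k, ∀ e ∈ F, R.seq k e = T e then 2 else 0) =
        Finset.card {k ∈ Finset.range (2 * Fintype.card E) | R.Crosses T F k} := by
    intro F hF
    split_ifs with h
    · obtain ⟨i, hi⟩ := h
      refine (card_crosses_of_agree (Finset.card_pos.mp ?_) hi).symm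
      rw [(Finset.mem_powersetCard.mp hF).2]
      omega
    · exact (Finset.card_eq_zero.mpr (Finset.filter_eq_empty_iff.mpr
        fun k _ hk => h (hk.exists_agree hT))).symm
  rw [Finset.sum_congr rfl hrow]
  simp only [Finset.card_filter]
  rw [Finset.sum_comm]
  refine Finset.sum_congr rfl fun k _ => ?_
  rw [← card_filter_crosses, Finset.card_filter]

theorem commonAgree_add_card (hT : ∀ e, T e ≠ 0) (k : ℕ) :
    R.commonAgree T (k + Fintype.card E) = Fintype.card E - 1 - R.commonAgree T k := by
  classical
  have h₁ : Finset.card {e ∈ Finset.univ.erase (R.flip k) | R.seq k e = T e} =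
      R.commonAgree T k := by
    unfold commonAgree
    congr 1
    ext e
    simp
  have h₂ : Finset.card {e ∈ Finset.univ.erase (R.flip k) | ¬ R.seq k e = T e} =
      R.commonAgree T (k + Fintype.card E) := by
    unfold commonAgree
    congr 1
    ext e
    have h : ∀ a b : SignType, a ≠ 0 → b ≠ 0 → (¬ a = b ↔ -a = b) := by decide
    simp [R.flip_add_card, R.seq_add_card, h _ _ (R.seq_ne_zero k e) (hT e)]
  have h := Finset.card_filter_add_card_filter_not (s := Finset.univ.erase (R.flip k))
    (fun e => R.seq k e = T e)
  rw [h₁, h₂, Finset.card_erase_of_mem (Finset.mem_univ _), Finset.card_univ] at h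
  omega

theorem commonAgree_le (k : ℕ) : R.commonAgree T k ≤ Fintype.card E - 1 := by
  classical
  rw [← Finset.card_univ, ← Finset.card_erase_of_mem (Finset.mem_univ (R.flip k))]
  refine Finset.card_le_card fun e he => ?_
  simpa using (Finset.mem_filter.mp he).2.1

/-- A step whose ends agree with `T` nowhere outside the negated entry starts or ends at `-T`; its
antipode then starts or ends at `T`. -/
theorem mem_range_of_commonAgree_eq_zero (hT : ∀ e, T e ≠ 0) {k : ℕ}
    (h : R.commonAgree T k = 0) : T ∈ Set.range R.seq := by
  classical
  have h' := commonAgree_add_card (R := R) hT k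
  set m := k + Fintype.card E with hm
  have hagree : ∀ e, e ≠ R.flip m → R.seq m e = T e := fun e he => by
    have h₀ := Finset.filter_eq_empty_iff.mp (Finset.card_eq_zero.mp h) (Finset.mem_univ e)
    rw [R.flip_add_card] at he
    rw [R.seq_add_card, Pi.neg_apply, SignType.eq_neg_of_ne (R.seq_ne_zero _ _) (hT _)
      fun h => h₀ ⟨he, h⟩, neg_neg]
  obtain ⟨j, hj⟩ := Crosses.exists_agree hT (F := Finset.univ) (k := m)
    ⟨Finset.mem_univ _, fun e _ he => hagree e he⟩
  exact ⟨j, funext fun e => hj e (Finset.mem_univ e)⟩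

/-- A vector of the cycle is its own decomposition. -/
theorem card_peaks_le_one_of_mem_range (h : T ∈ Set.range R.seq) : (R.peaks T).card ≤ 1 :=
  (Finset.card_le_card (peaks_subset_of_sum_eq (Q := {T}) (by simpa using h)
    (by simp))).trans (Finset.card_singleton T).le

end SignCycle

/-! ### The matrices as operations on polynomials -/

open Polynomial in
theorem coeff_one_sub_X_pow (m k : ℕ) :
    ((1 - X : ℤ[X]) ^ m).coeff k = (-1) ^ k * (m.choose k : ℤ) := by
  have h : (1 - X : ℤ[X]) ^ m = ((1 + X) ^ m).comp (C (-1) * X) := by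
    simp [sub_eq_add_neg]
  rw [h, comp_C_mul_X_coeff, coeff_one_add_X_pow, mul_comm]

open Polynomial in
theorem fToH_apply (t : ℕ) (j k : Fin (t + 1)) :
    fToH t j k = ((X : ℤ[X]) ^ (j : ℕ) * (1 - X) ^ (t - j : ℕ)).coeff k := by
  rw [coeff_X_pow_mul', fToH, Matrix.of_apply]
  simp_rw [coeff_one_sub_X_pow]

theorem vecMul_forwardShift_pow (t d : ℕ) (g : ℕ → ℤ) :
    (fun j : Fin (t + 1) => g j) ᵥ* forwardShift t ^ d =
      fun j : Fin (t + 1) => if d ≤ (j : ℕ) then g (j - d) else 0 := by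
  induction d with
  | zero => simp
  | succ d ih =>
    rw [pow_succ, ← Matrix.vecMul_vecMul, ih]
    funext j
    simp only [Matrix.vecMul, dotProduct, forwardShift, Matrix.of_apply, mul_ite, mul_one, mul_zero]
    by_cases hj : (j : ℕ) = 0
    · rw [if_neg (by omega), Finset.sum_eq_zero fun i _ => if_neg (by omega)]
    · rw [Finset.sum_eq_single_of_mem ⟨j - 1, by omega⟩ (Finset.mem_univ _) fun i _ hi =>
        if_neg fun h => hi (Fin.ext (by simp; omega))]
      rw [if_pos (by simp; omega)]
      refine if_congr (by simp; omega) ?_ rfl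
      congr 1
      simp; omega

theorem vecMul_backwardId (t : ℕ) (v : Fin (t + 1) → ℤ) :
    v ᵥ* backwardId t = fun j => v j.rev := by
  funext j
  simp only [Matrix.vecMul, dotProduct, backwardId, Matrix.of_apply, mul_ite, mul_one, mul_zero]
  rw [Finset.sum_eq_single_of_mem j.rev (Finset.mem_univ _) fun i _ hi =>
    if_neg fun h => hi (Fin.ext (by rw [Fin.val_rev]; omega))]
  exact if_pos (by rw [Fin.val_rev]; omega)

theorem backwardId_transpose (t : ℕ) : (backwardId t)ᵀ = backwardId t := by
  ext i j
  simp only [backwardId, Matrix.transpose_apply, Matrix.of_apply, add_comm]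

theorem backwardId_mulVec (t : ℕ) (v : Fin (t + 1) → ℤ) :
    backwardId t *ᵥ v = fun j => v j.rev := by
  rw [← vecMul_backwardId, ← Matrix.mulVec_transpose, backwardId_transpose]

theorem backwardId_mul_fToH_apply (t : ℕ) (i j : Fin (t + 1)) :
    (backwardId t * fToH t) i j.rev = (-1) ^ ((i : ℕ) + j) * ((i : ℕ).choose j : ℤ) := by
  have h : (backwardId t * fToH t) i j.rev = fToH t i.rev j.rev := by
    have := congrFun (backwardId_mulVec t fun k => fToH t k j.rev) i
    exact this
  rw [h, fToH, Matrix.of_apply, Fin.val_rev, Fin.val_rev]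
  have hi := i.is_lt
  have hj := j.is_lt
  split_ifs with hij
  · have hji : (j : ℕ) ≤ i := by omega
    rw [show t + 1 - (j + 1) - (t + 1 - (i + 1)) = (i - j : ℕ) by omega,
      show t - (t + 1 - ((i : ℕ) + 1)) = i by omega, Nat.choose_symm hji,
      show (i : ℕ) + j = (i - j) + 2 * j by omega, pow_add, pow_mul, neg_one_sq, one_pow, mul_one]
  · rw [Nat.choose_eq_zero_of_lt (by omega)]
    simp

theorem sum_range_choose_mul_choose {t i : ℕ} (hi : i ≤ t) (j : ℕ) :
    ∑ l ∈ Finset.range (t + 1), i.choose l * j.choose l = (i + j).choose i := by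
  rw [Nat.add_choose_eq, Finset.Nat.sum_antidiagonal_eq_sum_range_succ
    fun a b => i.choose a * j.choose b,
    ← Finset.sum_range_reflect fun k => i.choose k * j.choose (i - k)]
  refine (Finset.sum_subset (Finset.range_subset_range.mpr (by omega)) fun l _ hl => ?_).symm.trans
    (Finset.sum_congr rfl fun l hl => ?_)
  · rw [Nat.choose_eq_zero_of_lt (by simpa using hl), zero_mul]
  · have hl : l ≤ i := by simpa [Nat.lt_succ_iff] using hl
    rw [show i + 1 - 1 - l = i - l by omega, Nat.choose_symm hl, Nat.sub_sub_self hl]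

/-- The orthogonality relation for `M(t)` is that of the `h`-vectors: `M(t)` is the Gram matrix of
the rows of `U(t) S(t)`, by the Vandermonde identity. -/
theorem signedPascal_eq (t : ℕ) :
    signedPascal t = (backwardId t * fToH t) * (backwardId t * fToH t)ᵀ := by
  ext i j
  rw [Matrix.mul_apply, ← Equiv.sum_comp Fin.revPerm]
  simp only [Fin.revPerm_apply, Matrix.transpose_apply, backwardId_mul_fToH_apply]
  rw [signedPascal, Matrix.of_apply, ← sum_range_choose_mul_choose (Nat.lt_succ_iff.mp i.is_lt),
    Finset.sum_range, Nat.cast_sum, Finset.mul_sum]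
  refine Finset.sum_congr rfl fun l _ => ?_
  have h : (-1 : ℤ) ^ ((l : ℕ) + l) = 1 := by rw [← two_mul, pow_mul, neg_one_sq, one_pow]
  rw [Nat.cast_mul, pow_add, pow_add, pow_add]
  rw [pow_add] at h
  linear_combination (-(-1 : ℤ) ^ (i : ℕ) * (-1) ^ (j : ℕ) * (i : ℕ).choose l * (j : ℕ).choose l) * h

theorem vecMul_signedPascal_dotProduct (s t : ℕ) (L₁ : LowerSet (Finset (Fin s)))
    (L₂ : LowerSet (Finset (Fin t))) :
    ((binomVec s t - longF L₁ t) ᵥ* (forwardShift t ^ (t - s) * signedPascal t)) ⬝ᵥ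
      (binomVec t t - longF L₂ t) = dualLongH s t L₁ ⬝ᵥ dualLongH t t L₂ := by
  rw [dualLongH, dualLongH, Nat.sub_self, pow_zero, one_mul, signedPascal_eq, ← mul_assoc,
    ← Matrix.vecMul_vecMul, ← Matrix.dotProduct_mulVec, Matrix.mulVec_transpose, mul_assoc]

open Polynomial in
/-- The entries of `h(Ω; t)` as coefficients. -/
theorem dualLongH_apply {s t : ℕ} (hst : s ≤ t) (L : LowerSet (Finset (Fin s)))
    (k : Fin (t + 1)) :
    dualLongH s t L k = ((1 - X : ℤ[X]) ^ (t - s) * ∑ j ∈ Finset.range (s + 1),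
      C ((s.choose j : ℤ) - ({F : Finset (Fin s) | F ∈ L ∧ F.card = j}.ncard : ℤ)) *
        ((1 - X) ^ j * X ^ (s - j))).coeff k := by
  set g : ℕ → ℤ := fun j =>
    (s.choose j : ℤ) - ({F : Finset (Fin s) | F ∈ L ∧ F.card = j}.ncard : ℤ) with hg
  have hv : binomVec s t - longF L t = fun j : Fin (t + 1) => g j := rfl
  rw [dualLongH, hv, ← Matrix.vecMul_vecMul, ← Matrix.vecMul_vecMul, vecMul_forwardShift_pow,
    vecMul_backwardId, Finset.mul_sum, finsetSum_coeff]
  simp only [Matrix.vecMul, dotProduct, fToH_apply, Fin.val_rev]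
  refine (Fin.sum_univ_eq_sum_range (fun i => (if t - s ≤ t + 1 - (i + 1) then
    g (t + 1 - (i + 1) - (t - s)) else 0) * ((X : ℤ[X]) ^ i * (1 - X) ^ (t - i)).coeff (k : ℕ))
    (t + 1)).trans ?_
  rw [← Finset.sum_subset (Finset.range_subset_range.mpr (Nat.succ_le_succ hst)),
    ← Finset.sum_range_reflect]
  · refine Finset.sum_congr rfl fun j hj => ?_
    have hj : j ≤ s := Nat.lt_succ_iff.mp (Finset.mem_range.mp hj)
    rw [if_pos (by omega), ← coeff_C_mul]
    congr 1
    rw [show t + 1 - (s + 1 - 1 - j + 1) - (t - s) = j by omega,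
      show t - (s + 1 - 1 - j) = (t - s) + j by omega, show s + 1 - 1 - j = s - j by omega, pow_add]
    ring
  · intro i hi his
    rw [Finset.mem_range] at hi his
    rw [if_neg (by omega), zero_mul]

/-! ### The polynomial of the long `h`-vector -/

open Polynomial in
theorem sum_choose_mul_one_sub_X_pow {b m : ℕ} (hb : b ≤ m) :
    ∑ j ∈ Finset.range (m + 1), C (b.choose j : ℤ) * ((1 - X) ^ j * X ^ (m - j)) =
      X ^ (m - b) := by
  rw [← Finset.sum_subset (Finset.range_subset_range.mpr (Nat.succ_le_succ hb))]
  · have h := add_pow (1 - X : ℤ[X]) X b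
    rw [sub_add_cancel, one_pow] at h
    have h' : (X ^ (m - b) : ℤ[X]) = X ^ (m - b) *
        ∑ j ∈ Finset.range (b + 1), (1 - X) ^ j * X ^ (b - j) * (b.choose j : ℤ[X]) := by
      rw [← h, mul_one]
    rw [Finset.mul_sum] at h'
    refine Eq.trans (Finset.sum_congr rfl fun j hj => ?_) h'.symm
    have hj : j ≤ b := Nat.lt_succ_iff.mp (Finset.mem_range.mp hj)
    rw [show m - j = (m - b) + (b - j) by omega, pow_add]
    simp only [Int.cast_natCast, eq_intCast]
    ring
  · intro i _ hi
    rw [Nat.choose_eq_zero_of_lt (by simpa [Nat.lt_succ_iff] using hi)]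
    simp

open Polynomial in
/-- The doubled polynomial of the `h`-vector of a complex `Ω` for which `g j` counts the
nonfaces with `j` elements of the dual complex. -/
theorem two_mul_sum_one_sub_X_pow {m : ℕ} {ι : Type*} {A : Finset ι} {b : ι → ℕ} {g : ℕ → ℤ}
    (hb : ∀ i ∈ A, b i ≤ m) (hg₀ : g 0 = 0)
    (hg : ∀ j, 2 * g (j + 1) = 2 * ((m + 1).choose (j + 1) : ℤ) - ∑ i ∈ A, ((b i).choose j : ℤ)) :
    2 * ∑ j ∈ Finset.range (m + 1 + 1), C (g j) * ((1 - X) ^ j * X ^ (m + 1 - j)) =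
      2 * (1 - X ^ (m + 1)) - (1 - X) * ∑ i ∈ A, X ^ (m - b i) := by
  have h₁ := sum_choose_mul_one_sub_X_pow (le_refl (m + 1))
  rw [Finset.sum_range_succ'] at h₁ ⊢
  have h₂ : ∀ j, 2 * (C (g (j + 1)) * ((1 - X) ^ (j + 1) * X ^ (m + 1 - (j + 1))) : ℤ[X]) =
      2 * (C ((m + 1).choose (j + 1) : ℤ) * ((1 - X) ^ (j + 1) * X ^ (m + 1 - (j + 1)))) -
        (1 - X) * ∑ i ∈ A, C ((b i).choose j : ℤ) * ((1 - X) ^ j * X ^ (m - j)) := fun j => by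
    have h := congrArg (C : ℤ → ℤ[X]) (hg j)
    simp only [map_sub, map_mul, map_sum, C_ofNat] at h
    rw [← mul_assoc, h, ← Finset.sum_mul, Nat.add_sub_add_right]
    ring
  rw [mul_add, Finset.mul_sum, Finset.sum_congr rfl fun j _ => h₂ j, Finset.sum_sub_distrib,
    ← Finset.mul_sum, ← Finset.mul_sum, Finset.sum_comm,
    Finset.sum_congr rfl fun i hi => sum_choose_mul_one_sub_X_pow (hb i hi), hg₀]
  simp only [Nat.choose_zero_right, Nat.cast_one, map_one, pow_zero, one_mul, Nat.sub_zero,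
    Nat.sub_self] at h₁
  simp only [map_zero, zero_mul, mul_zero, add_zero]
  linear_combination 2 * h₁

open Polynomial in
theorem reflect_one_sub_X_pow (d : ℕ) :
    reflect d ((1 - X : ℤ[X]) ^ d) = (-1) ^ d * (1 - X) ^ d := by
  induction d with
  | zero => simp
  | succ d ih =>
    have h₁ : (1 - X : ℤ[X]).natDegree ≤ 1 := by compute_degree
    have h₂ : ((1 - X : ℤ[X]) ^ d).natDegree ≤ d := by compute_degree
    rw [pow_succ, reflect_mul _ _ h₂ h₁, ih, reflect_sub, reflect_one, reflect_one_X]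
    ring

open Polynomial in
/-- The polynomial of `h(Ω; t)` is palindromic up to sign: reversal maps `1 - X` to `-(1 - X)`,
and fixes the sum of the `X ^ b i` when the exponents are distributed symmetrically about
`m / 2`. -/
theorem reflect_longH {d m : ℕ} {ι : Type*} {A : Finset ι} {b : ι → ℕ} (hb : ∀ i ∈ A, b i ≤ m)
    (hsymm : ∑ i ∈ A, (X : ℤ[X]) ^ (m - b i) = ∑ i ∈ A, X ^ b i) :
    reflect (d + (m + 1)) ((1 - X : ℤ[X]) ^ d *
      (2 * (1 - X ^ (m + 1)) - (1 - X) * ∑ i ∈ A, X ^ b i)) =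
    (-1) ^ (d + 1) * ((1 - X : ℤ[X]) ^ d *
      (2 * (1 - X ^ (m + 1)) - (1 - X) * ∑ i ∈ A, X ^ b i)) := by
  have h₁ : (1 - X : ℤ[X]).natDegree ≤ 1 := by compute_degree
  have h₂ : ((1 - X : ℤ[X]) ^ d).natDegree ≤ d := by compute_degree
  have h₃ : (∑ i ∈ A, X ^ b i : ℤ[X]).natDegree ≤ m :=
    natDegree_sum_le_of_forall_le _ _ fun i hi => (natDegree_X_pow_le _).trans (hb i hi)
  have h₄ : ((1 - X : ℤ[X]) * ∑ i ∈ A, X ^ b i).natDegree ≤ m + 1 := by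
    rw [add_comm]
    exact natDegree_mul_le_of_le h₁ h₃
  have h₅ : (2 * (1 - X ^ (m + 1)) : ℤ[X]).natDegree ≤ m + 1 := by compute_degree
  have h₆ : reflect m (∑ i ∈ A, X ^ b i : ℤ[X]) = ∑ i ∈ A, X ^ b i := by
    have h := map_sum (AddMonoidHom.mk' (reflect m) fun f g : ℤ[X] => reflect_add f g m)
      (fun i => X ^ b i) A
    simp only [AddMonoidHom.mk'_apply] at h
    rw [h, ← hsymm]
    exact Finset.sum_congr rfl fun i hi => by rw [reflect_monomial, revAt_le (hb i hi)]
  have h₇ : reflect (m + 1) (2 * (1 - X ^ (m + 1)) : ℤ[X]) = -(2 * (1 - X ^ (m + 1))) := by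
    rw [← C_ofNat, reflect_C_mul, reflect_sub, reflect_one, reflect_monomial, revAt_le le_rfl]
    simp; ring
  rw [reflect_mul _ _ h₂ ((natDegree_sub_le _ _).trans (max_le h₅ h₄)), reflect_one_sub_X_pow,
    reflect_sub, h₇, add_comm m 1, reflect_mul _ _ h₁ h₃, h₆, reflect_sub, reflect_one,
    reflect_one_X]
  ring

/-! ### The Dehn–Sommerville type relations -/

namespace SignCycle

variable {s t : ℕ} {C : SignCycle (Fin s)} {T : SignVector (Fin s)}

open Polynomial in
theorem sum_X_pow_commonAgree (hT : ∀ e, T e ≠ 0) :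
    ∑ k ∈ Finset.range (2 * s), (X : ℤ[X]) ^ (s - 1 - C.commonAgree T k) =
      ∑ k ∈ Finset.range (2 * s), X ^ C.commonAgree T k := by
  have hcard := Fintype.card_fin s
  have hanti : ∀ k, C.commonAgree T (k + s) = s - 1 - C.commonAgree T k := fun k => by
    have := C.commonAgree_add_card hT k
    rwa [hcard] at this
  have hle : ∀ k, C.commonAgree T k ≤ s - 1 := fun k => by
    have := C.commonAgree_le (T := T) k
    rwa [hcard] at this
  rw [← sum_range_add_of_periodic (g := fun k => (X : ℤ[X]) ^ C.commonAgree T k) (fun k => ?_) s]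
  · exact Finset.sum_congr rfl fun k _ => by rw [add_comm s k, hanti]
  · have := hle k
    rw [two_mul, ← add_assoc, hanti, hanti]
    congr 1
    omega

open Polynomial in
/-- The doubled long `h`-vector, read off from the agreement numbers of the steps of the cycle. -/
theorem two_mul_dualLongH_peaks (hst : s ≤ t) (hT : ∀ e, T e ≠ 0) (k : Fin (t + 1)) :
    2 * dualLongH s t (decompositionComplex T (C.peaks T)) k =
      ((1 - X : ℤ[X]) ^ (t - s) * (2 * (1 - X ^ s) -
        (1 - X) * ∑ k ∈ Finset.range (2 * s), X ^ C.commonAgree T k)).coeff k := by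
  have hs : 0 < s := by simpa using C.card_pos
  obtain ⟨m, rfl⟩ : ∃ m, s = m + 1 := ⟨s - 1, by omega⟩
  rw [dualLongH_apply hst, ← sum_X_pow_commonAgree hT, Nat.add_sub_cancel,
    ← two_mul_sum_one_sub_X_pow (g := fun j => ((m + 1).choose j : ℤ) -
      ({F : Finset (Fin (m + 1)) | F ∈ decompositionComplex T (C.peaks T) ∧ F.card = j}.ncard : ℤ))]
  · rw [mul_left_comm, coeff_ofNat_mul]
  · intro k _
    have := C.commonAgree_le (T := T) k
    simpa using this
  · have hzero : {F : Finset (Fin (m + 1)) |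
        F ∈ decompositionComplex T (C.peaks T) ∧ F.card = 0} = {∅} := by
      ext F
      simp only [mem_decompositionComplex_peaks hT, Set.mem_ofPred_eq, Finset.card_eq_zero,
        Set.mem_singleton_iff, and_iff_right_iff_imp]
      rintro rfl
      exact ⟨0, by simp⟩
    simp only [hzero, Set.ncard_singleton, Nat.choose_zero_right, sub_self]
  · intro j
    have h := two_mul_ncard_faces (R := C) hT j
    rw [Fintype.card_fin] at h
    simp only [mem_decompositionComplex_peaks hT]
    rw [mul_sub, ← Nat.cast_sum, ← h]
    push_cast
    rfl

theorem dualLongH_peaks_rev (hst : s ≤ t) (hT : ∀ e, T e ≠ 0) (k : Fin (t + 1)) :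
    dualLongH s t (decompositionComplex T (C.peaks T)) k.rev =
      (-1) ^ (t - s + 1) * dualLongH s t (decompositionComplex T (C.peaks T)) k := by
  have hs : 0 < s := by simpa using C.card_pos
  obtain ⟨m, rfl⟩ : ∃ m, s = m + 1 := ⟨s - 1, by omega⟩
  have hb : ∀ k ∈ Finset.range (2 * (m + 1)), C.commonAgree T k ≤ m := fun k _ => by
    simpa using C.commonAgree_le (T := T) k
  have h := reflect_longH (d := t - (m + 1)) hb (by simpa using sum_X_pow_commonAgree hT)
  rw [Nat.sub_add_cancel hst] at h
  have hk := Polynomial.ext_iff.mp h k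
  have hneg : ((-1 : Polynomial ℤ)) ^ (t - (m + 1) + 1) =
      Polynomial.C ((-1 : ℤ) ^ (t - (m + 1) + 1)) := by simp
  rw [Polynomial.coeff_reflect, Polynomial.revAt_le (Nat.lt_succ_iff.mp k.is_lt), hneg,
    Polynomial.coeff_C_mul, ← two_mul_dualLongH_peaks hst hT k,
    show t - (k : ℕ) = (k.rev : ℕ) by rw [Fin.val_rev]; omega,
    ← two_mul_dualLongH_peaks hst hT k.rev] at hk
  linarith

/-- The entry `h₀` is `1`, for lack of an agreement with all of `T`. -/
theorem dualLongH_peaks_ne_zero (hst : s ≤ t) (hT : ∀ e, T e ≠ 0)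
    (hQ : 1 < (C.peaks T).card) : dualLongH s t (decompositionComplex T (C.peaks T)) ≠ 0 := by
  have hs : 0 < s := by simpa using C.card_pos
  intro h
  have h₀ := two_mul_dualLongH_peaks (C := C) hst hT 0
  have hpos : ∀ k, C.commonAgree T k ≠ 0 := fun k hk =>
    hQ.not_ge (card_peaks_le_one_of_mem_range (mem_range_of_commonAgree_eq_zero hT hk))
  rw [h, Fin.val_zero, Polynomial.coeff_zero_eq_eval_zero] at h₀
  simp [Polynomial.eval_finsetSum, hs.ne', hpos] at h₀

end SignCycle

theorem dotProduct_eq_zero_of_rev {t : ℕ} {u v : Fin (t + 1) → ℤ} (hu : ∀ k, u k = u k.rev)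
    (hv : ∀ k, v k = -v k.rev) : u ⬝ᵥ v = 0 := by
  have h : u ⬝ᵥ v = -(u ⬝ᵥ v) := by
    conv_lhs => rw [dotProduct, ← Equiv.sum_comp Fin.revPerm]
    rw [dotProduct, ← Finset.sum_neg_distrib]
    refine Finset.sum_congr rfl fun k _ => ?_
    rw [Fin.revPerm_apply, ← hu, hv k, mul_neg, neg_neg]
  omega

theorem mainTheorem1 (s t : ℕ) (hst : s < t) (hpar : ¬ s ≡ t [MOD 2])
    (M₁ : OrientedMatroid (Fin s)) (M₂ : OrientedMatroid (Fin t))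
    (hM₁ : M₁.IsSimple) (hM₂ : M₂.IsSimple)
    (R₁ : M₁.SymmetricCycle) (R₂ : M₂.SymmetricCycle)
    (T₁ : M₁.topes) (T₂ : M₂.topes) :
    (∃! Q₁, OrientedMatroid.IsMinimalDecomposition T₁ R₁ Q₁) ∧
    (∃! Q₂, OrientedMatroid.IsMinimalDecomposition T₂ R₂ Q₂) ∧
    ∀ Q₁ Q₂, OrientedMatroid.IsMinimalDecomposition T₁ R₁ Q₁ →
      OrientedMatroid.IsMinimalDecomposition T₂ R₂ Q₂ →
      5 ≤ Q₁.card → 5 ≤ Q₂.card →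
      ∀ (L₁ : LowerSet (Finset (Fin s))) (L₂ : LowerSet (Finset (Fin t))),
        L₁ = decompositionComplex T₁.1 Q₁ →
        L₂ = decompositionComplex T₂.1 Q₂ →
        -- the orthogonality relation
        ((binomVec s t - longF L₁ t) ᵥ* (forwardShift t ^ (t - s) * signedPascal t)) ⬝ᵥ
            (binomVec t t - longF L₂ t) = 0 ∧
        -- the relations of Dehn-Sommerville type for the long `h`-vectors
        (∀ k, dualLongH s t L₁ k = dualLongH s t L₁ k.rev) ∧
        (∀ k, dualLongH t t L₂ k = -dualLongH t t L₂ k.rev) ∧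
        -- left and right eigenvectors of the backward identity matrix, orthogonal to each other
        (dualLongH s t L₁ ≠ 0 ∧ dualLongH s t L₁ ᵥ* backwardId t = dualLongH s t L₁) ∧
        (dualLongH t t L₂ ≠ 0 ∧ backwardId t *ᵥ dualLongH t t L₂ = -dualLongH t t L₂) ∧
        dualLongH s t L₁ ⬝ᵥ dualLongH t t L₂ = 0 := by

  obtain ⟨C₁, hC₁⟩ := R₁.exists_signCycle hM₁
  obtain ⟨C₂, hC₂⟩ := R₂.exists_signCycle hM₂
  have hT₁ := hM₁.tope_ne_zero T₁.2
  have hT₂ := hM₂.tope_ne_zero T₂.2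
  simp only [OrientedMatroid.isMinimalDecomposition_iff hM₁ hC₁,
    OrientedMatroid.isMinimalDecomposition_iff hM₂ hC₂]
  refine ⟨existsUnique_eq, existsUnique_eq, ?_⟩
  rintro _ _ rfl rfl h₁ h₂ _ _ rfl rfl
  have hsymm : ∀ k, dualLongH s t (decompositionComplex T₁.1 (C₁.peaks T₁.1)) k =
      dualLongH s t (decompositionComplex T₁.1 (C₁.peaks T₁.1)) k.rev := fun k => by
    have hodd : Even (t - s + 1) := by
      rw [Nat.ModEq] at hpar
      rw [Nat.even_iff]
      omega
    rw [C₁.dualLongH_peaks_rev hst.le hT₁, hodd.neg_one_pow, one_mul]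
  have hanti : ∀ k, dualLongH t t (decompositionComplex T₂.1 (C₂.peaks T₂.1)) k =
      -dualLongH t t (decompositionComplex T₂.1 (C₂.peaks T₂.1)) k.rev := fun k => by
    rw [C₂.dualLongH_peaks_rev le_rfl hT₂, Nat.sub_self, zero_add, pow_one, neg_one_mul, neg_neg]
  have hdot := dotProduct_eq_zero_of_rev hsymm hanti
  refine ⟨?_, hsymm, hanti, ⟨C₁.dualLongH_peaks_ne_zero hst.le hT₁ (by omega), ?_⟩,
    ⟨C₂.dualLongH_peaks_ne_zero le_rfl hT₂ (by omega), ?_⟩, hdot⟩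
  · rw [vecMul_signedPascal_dotProduct, hdot]
  · rw [vecMul_backwardId]
    exact funext fun k => (hsymm k).symm
  · rw [backwardId_mulVec]
    funext k
    rw [Pi.neg_apply, hanti k, neg_neg]
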